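/- All graphs are finite, simple and undirected. For a graph $G$, the Gallai graph $\Gamma(G)$ has vertex set $E(G)$, and two distinct edges $e,f$ of $G$ are adjacent in $\Gamma(G)$ if they share an endpoint but do not span a triangle in $G$, i.e. if $e=uv$ and $f=uw$ with $v\neq w$ and $vw\notin E(G)$. A graph is chordal if it has no induced cycle of length at least $4$, and it is a forest if it contains no cycle. Define the following graphs. - $F_1$ is the claw $K_{1,3}$. - $F_2$ consists of two triangles sharing exactly one vertex. - $F_3$ arises from a complete graph on $\{a,b,c,d\}$ by adding a vertex with neighbourhood $\{a,b\}$ and a vertex with neighbourhood $\{c,d\}$. - $F_4$ (the net) is a triangle with one pendant edge attached at each of its vertices. - $F_5$ (the $3$-sun) arises from a triangle by adding, for each of its edges $xy$, a new vertex with neighbourhood $\{x,y\}$. - $F_6$ arises from a path $p_1p_2p_3p_4p_5$ by adding a vertex with neighbourhood $\{p_2,p_3,p_4\}$. - $F_7$ arises from a path $p_1p_2p_3p_4p_5p_6$ by adding a vertex with neighbourhood $\{p_2,p_3,p_4,p_5\}$. - $F_8$ is the square of the path $p_1p_2\ldots p_7$, i.e. $p_i$ and $p_j$ are adjacent if and only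 if $1\le|i-j|\le 2$. - $F_9$ arises from the square of the path $p_1p_2\ldots p_6$ by adding a vertex with neighbourhood $\{p_2,p_3,p_4,p_5\}$. **Theorem.** For every graph $G$, the Gallai graph $\Gamma(G)$ is a forest if and only if $G$ is chordal and none of $F_1,\ldots,F_9$ is isomorphic to an induced subgraph of $G$. -/

import Mathlib

namespace SimpleGraph

/-- The Gallai graph of `G`: its vertices are the edges of `G`; two distinct edges `e` and `f` are
adjacent if they share an endpoint `u`, say `e = uv` and `f = uw`, and `vw` is not an edge of `G`
(that is, `e` and `f` are adjacent edges of `G` that do not span a triangle). -/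
def gallaiGraph {V : Type*} (G : SimpleGraph V) : SimpleGraph G.edgeSet where
  Adj e f := e ≠ f ∧ ∃ u v w : V, (e : Sym2 V) = s(u, v) ∧ (f : Sym2 V) = s(u, w) ∧ ¬ G.Adj v w
  symm := ⟨by
    rintro e f ⟨hne, u, v, w, he, hf, h⟩
    exact ⟨hne.symm, u, w, v, hf, he, fun h' => h h'.symm⟩⟩
  loopless := ⟨fun _ h => h.1 rfl⟩

/-- A graph is chordal if it has no chordless cycle of length at least four, that is, no induced
subgraph that is a cycle on at least four vertices. -/
def IsChordal {V : Type*} (G : SimpleGraph V) : Prop :=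
  ∀ n : ℕ, 4 ≤ n → ¬ (cycleGraph n).IsIndContained G

end SimpleGraph

namespace GallaiForest

/-- The claw. -/
def F1 : SimpleGraph (Fin 4) :=
  SimpleGraph.fromEdgeSet {s(0, 3), s(3, 1), s(2, 3)}

/-- Two triangles sharing exactly one vertex. -/
def F2 : SimpleGraph (Fin 5) :=
  SimpleGraph.fromEdgeSet {s(0, 1), s(1, 4), s(4, 0), s(2, 3), s(3, 4), s(4, 2)}

/-- A complete graph on `1, 2, 4, 5`, with a vertex `0` joined to `1, 5` and a vertex `3` joined
to `2, 4`. -/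
def F3 : SimpleGraph (Fin 6) :=
  SimpleGraph.fromEdgeSet
    {s(0, 1), s(1, 2), s(2, 3), s(3, 4), s(4, 5), s(5, 0),
     s(1, 4), s(4, 2), s(2, 5), s(5, 1)}

/-- The net: a triangle `1, 2, 4` with one pendant edge at each vertex. -/
def F4 : SimpleGraph (Fin 6) :=
  SimpleGraph.fromEdgeSet {s(0, 1), s(1, 2), s(2, 3), s(1, 4), s(4, 2), s(4, 5)}

/-- The 3-sun: a triangle `1, 3, 4` with, for each of its edges, a further vertex joined to the
two ends of that edge. -/
def F5 : SimpleGraph (Fin 6) :=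
  SimpleGraph.fromEdgeSet
    {s(0, 1), s(1, 2), s(2, 4), s(4, 5), s(5, 3), s(3, 0),
     s(1, 3), s(3, 4), s(4, 1)}

/-- A path `0, 1, 2, 3, 4` and a vertex `5` joined to the three interior vertices of the path. -/
def F6 : SimpleGraph (Fin 6) :=
  SimpleGraph.fromEdgeSet
    {s(0, 1), s(1, 2), s(2, 3), s(3, 4), s(1, 5), s(5, 3), s(2, 5)}

/-- A path `0, 1, 2, 3, 4, 5` and a vertex `6` joined to the four interior vertices of the path. -/
def F7 : SimpleGraph (Fin 7) :=
  SimpleGraph.fromEdgeSet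
    {s(0, 1), s(1, 2), s(2, 3), s(3, 4), s(4, 5),
     s(1, 6), s(6, 2), s(3, 6), s(6, 4)}

/-- The square of the path `0, 4, 1, 5, 2, 6, 3`. -/
def F8 : SimpleGraph (Fin 7) :=
  SimpleGraph.fromEdgeSet
    {s(0, 1), s(1, 2), s(2, 3), s(3, 6), s(6, 5), s(5, 4), s(4, 0),
     s(4, 1), s(1, 5), s(5, 2), s(2, 6)}

/-- The square of the path `0, 3, 1, 4, 2, 5`, and a vertex `6` joined to `1, 2, 3, 4`. -/
def F9 : SimpleGraph (Fin 7) :=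
  SimpleGraph.fromEdgeSet
    {s(0, 1), s(1, 2), s(2, 5), s(5, 4), s(4, 3), s(3, 0),
     s(3, 1), s(1, 4), s(4, 2),
     s(1, 6), s(6, 2), s(3, 6), s(6, 4)}

end GallaiForest

/-!
The Gallai graph of an induced subgraph of `G` is an induced subgraph of the Gallai graph of `G`, so
for one direction it suffices to exhibit a cycle in the Gallai graph of each obstruction
(`not_isAcyclic_gallaiGraph`).

For the converse, let `G` be chordal without the nine obstructions, and suppose that its Gallai
graph has a cycle. The edges of `G` on this cycle form a core (`IsGallaiCore`): each has at least two
Gallai neighbours among them. The core has no turn, that is, no edge `ij` with two neighbours `jk`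
and `jk'` at the same end `j`; this is `IsTurn.false`, the heart of the proof. So a pair of adjacent
edges of the core can be prolonged for ever to a walk `x₀ x₁ x₂ …` of `G` in which `xₙ` and `xₙ₊₂`
are always distinct and nonadjacent. In a chordal graph such a walk is an induced path
(`IsChordal.induced_path`), which is absurd as `G` is finite (`IsGallaiCore.false`).

That turns do not exist is a local matter. Think of a proper interval graph, with vertices ordered
from left to right, which is what a graph without claws, nets, 3-suns and chordless cycles looks
like; the Gallai neighbours of an edge then lie to its left or to its right, and a turn is an edge
`ij` with two neighbours `jk`, `jk'` to its right. Neither of these has another neighbour on the left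
(`IsTurn.no_sink`), so both go on to the right, to `kl` and `k'l'`, where `l` may be taken to be
adjacent to `k'` by symmetry (`IsTurn.adj_or_adj`). Now `kl` has a second neighbour in the core. If
it is on the right, the core runs into an obstruction after at most two more steps
(`IsTurn.no_path`). If it is an edge `j'k` on the left, there is a turn in the opposite direction at
`kl`, and the two turns together contain an obstruction (`IsTurn.no_clique`, `IsTurn.no_crossing`).
No linear order is used in the proof itself: what it would give for the few vertices involved
follows from the absence of short chordless cycles, claws, nets and 3-suns.
-/

/-! ### Cycles in the Gallai graphs of the obstructions -/

namespace SimpleGraph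

variable {V W : Type*} {G : SimpleGraph V} {H : SimpleGraph W}

/-- The Gallai graph is functorial for induced subgraphs, so acyclicity passes down. -/
theorem IsIndContained.isAcyclic_gallaiGraph (hHG : H.IsIndContained G)
    (hG : G.gallaiGraph.IsAcyclic) : H.gallaiGraph.IsAcyclic := by
  obtain ⟨φ⟩ := hHG
  refine hG.comap ⟨φ.mapEdgeSet, ?_⟩ φ.mapEdgeSet.injective
  rintro e f ⟨hne, u, v, w, he, hf, h⟩
  refine ⟨fun h' => hne (φ.mapEdgeSet.injective h'), φ u, φ v, φ w, ?_, ?_, ?_⟩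
  · change Sym2.map φ e = _
    rw [he, Sym2.map_mk]
  · change Sym2.map φ f = _
    rw [hf, Sym2.map_mk]
  · rwa [φ.map_adj_iff]

/-- A cycle of the Gallai graph in coordinates: its `t`-th vertex is the edge `s(c t, l t)`, and
`c t` is the endpoint shared with the next one, which is `s(c t, r t)`. -/
theorem not_isAcyclic_gallaiGraph {k : ℕ} (c l r : Fin (k + 3) → V)
    (hadj : ∀ t, G.Adj (c t) (l t)) (hnadj : ∀ t, ¬ G.Adj (l t) (r t))
    (hnext : ∀ t, s(c (t + 1), l (t + 1)) = s(c t, r t))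
    (hinj : ∀ t t', s(c t, l t) = s(c t', l t') → t = t') :
    ¬ G.gallaiGraph.IsAcyclic := by
  rw [isAcyclic_iff_free_cycleGraph]
  intro h
  let e : Fin (k + 3) → G.edgeSet := fun t => ⟨s(c t, l t), hadj t⟩
  have he : Function.Injective e := fun t t' htt' => hinj t t' (congrArg Subtype.val htt')
  have hstep : ∀ t, G.gallaiGraph.Adj (e t) (e (t + 1)) := fun t =>
    ⟨fun h' => by simpa using he h', c t, l t, r t, rfl, hnext t, hnadj t⟩
  refine h (k + 3) (by omega) ⟨⟨⟨e, ?_⟩, he⟩⟩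
  intro a b hab
  rcases cycleGraph_adj.1 hab with h' | h'
  · rw [sub_eq_iff_eq_add'.1 h']
    exact (hstep b).symm
  · rw [sub_eq_iff_eq_add'.1 h']
    exact hstep a

open Fin.CommRing in
/-- The Gallai graph of a cycle of length at least four is again a cycle. -/
theorem not_isAcyclic_gallaiGraph_cycleGraph {n : ℕ} (hn : 4 ≤ n) :
    ¬ (cycleGraph n).gallaiGraph.IsAcyclic := by
  obtain ⟨n, rfl⟩ := Nat.exists_eq_add_of_le' hn
  have h1 : (1 : Fin (n + 4)).val = 1 := by simp
  have h2 : (2 : Fin (n + 4)).val = 2 := rfl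
  have h3 : (3 : Fin (n + 4)).val = 3 := rfl
  apply not_isAcyclic_gallaiGraph (k := n + 1) (fun t : Fin (n + 4) => t + 1) (fun t => t)
    (fun t => t + 1 + 1)
  · intro t
    exact cycleGraph_adj.2 (Or.inl (add_sub_cancel_left t 1))
  · intro t h
    rcases cycleGraph_adj.1 h with h | h
    · have h' : (3 : Fin (n + 4)) = 0 := by linear_combination -h
      exact absurd (congrArg Fin.val h') (by rw [h3]; simp)
    · have h' : (1 : Fin (n + 4)) = 0 := by linear_combination h
      exact absurd (congrArg Fin.val h') (by rw [h1]; simp)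
  · intro t
    exact Sym2.eq_swap
  · intro t t' h
    rcases Sym2.eq_iff.1 h with h | ⟨h, h'⟩
    · exact h.2
    · have h' : (2 : Fin (n + 4)) = 0 := by linear_combination h - h'
      exact absurd (congrArg Fin.val h') (by rw [h2]; simp)

instance decidableRelAdjFromEdgeSet [DecidableEq V] (s : Set (Sym2 V)) [DecidablePred (· ∈ s)] :
    DecidableRel (fromEdgeSet s).Adj :=
  fun a b => decidable_of_iff (s(a, b) ∈ s ∧ a ≠ b) (fromEdgeSet_adj s).symm

end SimpleGraph

namespace GallaiForest

open SimpleGraph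

instance : DecidableRel F1.Adj := by unfold F1; infer_instance
instance : DecidableRel F2.Adj := by unfold F2; infer_instance
instance : DecidableRel F3.Adj := by unfold F3; infer_instance
instance : DecidableRel F4.Adj := by unfold F4; infer_instance
instance : DecidableRel F5.Adj := by unfold F5; infer_instance
instance : DecidableRel F6.Adj := by unfold F6; infer_instance
instance : DecidableRel F7.Adj := by unfold F7; infer_instance
instance : DecidableRel F8.Adj := by unfold F8; infer_instance
instance : DecidableRel F9.Adj := by unfold F9; infer_instance

theorem F1_not_isAcyclic : ¬ F1.gallaiGraph.IsAcyclic :=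
  not_isAcyclic_gallaiGraph ![3, 3, 3] ![0, 1, 2] ![1, 2, 0]
    (by decide) (by decide) (by decide) (by decide)

theorem F2_not_isAcyclic : ¬ F2.gallaiGraph.IsAcyclic :=
  not_isAcyclic_gallaiGraph ![4, 4, 4, 4] ![1, 3, 0, 2] ![3, 0, 2, 1]
    (by decide) (by decide) (by decide) (by decide)

theorem F3_not_isAcyclic : ¬ F3.gallaiGraph.IsAcyclic :=
  not_isAcyclic_gallaiGraph ![1, 2, 2, 5, 5, 4, 4, 1] ![0, 1, 3, 2, 0, 5, 3, 4]
    ![2, 3, 5, 0, 4, 3, 1, 0] (by decide) (by decide) (by decide) (by decide)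

theorem F4_not_isAcyclic : ¬ F4.gallaiGraph.IsAcyclic :=
  not_isAcyclic_gallaiGraph ![1, 2, 2, 4, 4, 1] ![0, 1, 3, 2, 5, 4] ![2, 3, 4, 5, 1, 0]
    (by decide) (by decide) (by decide) (by decide)

theorem F5_not_isAcyclic : ¬ F5.gallaiGraph.IsAcyclic :=
  not_isAcyclic_gallaiGraph ![1, 1, 3, 3, 3, 4, 4, 4, 1] ![0, 2, 1, 5, 0, 3, 2, 5, 4]
    ![2, 3, 5, 0, 4, 2, 5, 1, 0] (by decide) (by decide) (by decide) (by decide)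

theorem F6_not_isAcyclic : ¬ F6.gallaiGraph.IsAcyclic :=
  not_isAcyclic_gallaiGraph ![1, 2, 3, 3, 5, 1] ![0, 1, 2, 4, 3, 5] ![2, 3, 4, 5, 1, 0]
    (by decide) (by decide) (by decide) (by decide)

theorem F7_not_isAcyclic : ¬ F7.gallaiGraph.IsAcyclic :=
  not_isAcyclic_gallaiGraph ![1, 2, 3, 4, 4, 6, 1] ![0, 1, 2, 3, 5, 4, 6] ![2, 3, 4, 5, 6, 1, 0]
    (by decide) (by decide) (by decide) (by decide)

theorem F8_not_isAcyclic : ¬ F8.gallaiGraph.IsAcyclic :=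
  not_isAcyclic_gallaiGraph ![1, 2, 2, 5, 5, 5, 1] ![0, 1, 3, 2, 4, 6, 5] ![2, 3, 5, 4, 6, 1, 0]
    (by decide) (by decide) (by decide) (by decide)

theorem F9_not_isAcyclic : ¬ F9.gallaiGraph.IsAcyclic :=
  not_isAcyclic_gallaiGraph ![1, 2, 2, 6, 3, 3, 4, 4, 1] ![0, 1, 5, 2, 6, 0, 3, 5, 4]
    ![2, 5, 6, 3, 0, 4, 5, 1, 0] (by decide) (by decide) (by decide) (by decide)

end GallaiForest

/-! ### Induced paths in chordal graphs -/

namespace SimpleGraph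

variable {V : Type*} {G : SimpleGraph V}

theorem isIndContained_of_forall_lt {n : ℕ} {F : SimpleGraph (Fin n)} (f : Fin n → V)
    (hadj : ∀ i j, i < j → F.Adj i j → G.Adj (f i) (f j))
    (hcompl : ∀ i j, i < j → ¬ F.Adj i j → f i ≠ f j ∧ ¬ G.Adj (f i) (f j)) :
    F.IsIndContained G := by
  have hne : ∀ i j, i < j → f i ≠ f j := fun i j hij => by
    by_cases h : F.Adj i j
    · exact (hadj i j hij h).ne
    · exact (hcompl i j hij h).1
  have hiff : ∀ i j, i < j → (G.Adj (f i) (f j) ↔ F.Adj i j) := fun i j hij =>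
    ⟨fun h => by_contra fun h' => (hcompl i j hij h').2 h, hadj i j hij⟩
  refine ⟨⟨⟨f, fun i j hij => ?_⟩, fun {i j} => ?_⟩⟩
  · by_contra h
    rcases lt_or_gt_of_ne h with h | h
    · exact hne i j h hij
    · exact hne j i h hij.symm
  · rcases lt_trichotomy i j with h | rfl | h
    · exact hiff i j h
    · simp
    · rw [F.adj_comm i j]
      exact (G.adj_comm _ _).trans (hiff j i h)

/-- In a chordal graph a walk whose vertices at distance two are distinct and nonadjacent is an
induced path: a shortest chord would close an induced cycle of length at least four. -/
theorem IsChordal.induced_path (hG : G.IsChordal) (x : ℕ → V) (n : ℕ)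
    (h1 : ∀ i, i + 1 ≤ n → G.Adj (x i) (x (i + 1)))
    (h2 : ∀ i, i + 2 ≤ n → Gᶜ.Adj (x i) (x (i + 2))) :
    ∀ d i, 2 ≤ d → i + d ≤ n → Gᶜ.Adj (x i) (x (i + d)) := by
  intro d
  induction d using Nat.strong_induction_on with
  | _ d ih =>
    intro i hd hi
    obtain rfl | hd : d = 2 ∨ 3 ≤ d := by omega
    · exact h2 i hi
    rw [compl_adj]
    -- if the two ends coincided, the last step would be an edge at distance `d - 1`
    have hne : x i ≠ x (i + d) := by
      intro h
      have := ih (d - 1) (by omega) i (by omega) (by omega)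
      rw [compl_adj, h] at this
      have h' := h1 (i + (d - 1)) (by omega)
      rw [show i + (d - 1) + 1 = i + d by omega] at h'
      exact this.2 h'.symm
    refine ⟨hne, fun hadj => hG (d + 1) (by omega) ?_⟩
    apply isIndContained_of_forall_lt (fun t => x (i + t))
    · intro a b hab h
      rw [cycleGraph_adj'] at h
      have hb := b.2
      rw [Fin.lt_def] at hab
      rw [Fin.coe_sub_iff_lt.2 hab, Fin.coe_sub_iff_le.2 hab.le] at h
      rcases h with h | h
      · obtain ⟨ha, hb⟩ : a.val = 0 ∧ b.val = d := by omega
        simpa only [ha, hb, add_zero] using hadj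
      · rw [show b.val = a.val + 1 by omega]
        exact h1 (i + a) (by omega)
    · intro a b hab h
      rw [cycleGraph_adj'] at h
      have hb := b.2
      rw [Fin.lt_def] at hab
      rw [Fin.coe_sub_iff_lt.2 hab, Fin.coe_sub_iff_le.2 hab.le] at h
      have := ih (b.val - a.val) (by omega) (i + a) (by omega) (by omega)
      rw [compl_adj, show i + a.val + (b.val - a.val) = i + b.val by omega] at this
      exact this

end SimpleGraph

/-! ### Local rules in graphs without the obstructions -/

namespace GallaiForest

open SimpleGraph

variable {V : Type*} {G : SimpleGraph V}

/-- Chordal graphs that contain none of `F1`, …, `F9` as an induced subgraph. -/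
structure ObstructionFree (G : SimpleGraph V) : Prop where
  chordal : G.IsChordal
  f1 : ¬ F1.IsIndContained G
  f2 : ¬ F2.IsIndContained G
  f3 : ¬ F3.IsIndContained G
  f4 : ¬ F4.IsIndContained G
  f5 : ¬ F5.IsIndContained G
  f6 : ¬ F6.IsIndContained G
  f7 : ¬ F7.IsIndContained G
  f8 : ¬ F8.IsIndContained G
  f9 : ¬ F9.IsIndContained G

namespace ObstructionFree

theorem four_cycle (hG : ObstructionFree G) {a b c d : V} (hab : G.Adj a b) (hbc : G.Adj b c)
    (hcd : G.Adj c d) (hda : G.Adj d a) : a = c ∨ b = d ∨ G.Adj a c ∨ G.Adj b d := by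
  by_contra! h
  apply hG.chordal 4 le_rfl
  apply isIndContained_of_forall_lt ![a, b, c, d]
  · simp only [Fin.forall_fin_succ]
    simp [cycleGraph_adj]
    grind [G.adj_comm]
  · simp only [Fin.forall_fin_succ]
    simp [cycleGraph_adj]
    grind [G.adj_comm]

theorem claw (hG : ObstructionFree G) {a b c d : V} (ha : G.Adj d a) (hb : G.Adj d b)
    (hc : G.Adj d c) : a = b ∨ a = c ∨ b = c ∨ G.Adj a b ∨ G.Adj a c ∨ G.Adj b c := by
  by_contra! h
  apply hG.f1
  apply isIndContained_of_forall_lt ![a, b, c, d] <;>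
  · simp only [Fin.forall_fin_succ]
    simp [F1]
    grind [G.adj_comm]

theorem butterfly (hG : ObstructionFree G) {a₁ a₂ b₁ b₂ c : V}
    (ha : G.Adj a₁ a₂) (ha₁ : G.Adj a₁ c) (ha₂ : G.Adj a₂ c)
    (hb : G.Adj b₁ b₂) (hb₁ : G.Adj b₁ c) (hb₂ : G.Adj b₂ c) :
    G.Adj a₁ b₁ ∨ G.Adj a₁ b₂ ∨ G.Adj a₂ b₁ ∨ G.Adj a₂ b₂ ∨ a₁ = b₁ := by
  by_contra! h
  apply hG.f2
  apply isIndContained_of_forall_lt ![a₁, a₂, b₁, b₂, c] <;>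
  · simp only [Fin.forall_fin_succ]
    simp [F2]
    grind [G.adj_comm]

/-- A clique `a b c d` with a vertex `e` attached to `a b` and a vertex `f` attached to `c d`. -/
theorem clique_four (hG : ObstructionFree G) {e a b c d f : V}
    (hea : G.Adj e a) (heb : G.Adj e b) (hab : G.Adj a b) (hac : G.Adj a c) (had : G.Adj a d)
    (hbc : G.Adj b c) (hbd : G.Adj b d) (hcd : G.Adj c d) (hcf : G.Adj c f) (hdf : G.Adj d f)
    (nec : ¬ G.Adj e c) (ned : ¬ G.Adj e d) (nef : ¬ G.Adj e f) (naf : ¬ G.Adj a f)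
    (nbf : ¬ G.Adj b f) :
    False := by
  apply hG.f3
  apply isIndContained_of_forall_lt ![e, a, c, f, d, b] <;>
  · simp only [Fin.forall_fin_succ]
    simp [F3]
    grind [G.adj_comm]

/-- A triangle `a b c` with pendant vertices `d`, `e`, `f`. -/
theorem net (hG : ObstructionFree G) {a b c d e f : V}
    (hab : G.Adj a b) (hac : G.Adj a c) (had : G.Adj a d) (hbc : G.Adj b c) (hbe : G.Adj b e)
    (hcf : G.Adj c f)
    (nae : ¬ G.Adj a e) (naf : ¬ G.Adj a f) (nbd : ¬ G.Adj b d) (nbf : ¬ G.Adj b f)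
    (ncd : ¬ G.Adj c d) (nce : ¬ G.Adj c e) (nde : ¬ G.Adj d e) (ndf : ¬ G.Adj d f)
    (nef : ¬ G.Adj e f) :
    False := by
  apply hG.f4
  apply isIndContained_of_forall_lt ![d, a, b, e, c, f] <;>
  · simp only [Fin.forall_fin_succ]
    simp [F4]
    grind [G.adj_comm]

/-- A triangle `a b c` with vertices `d`, `e`, `f` attached to its edges `a b`, `b c`, `c a`. -/
theorem sun (hG : ObstructionFree G) {a b c d e f : V}
    (hab : G.Adj a b) (hac : G.Adj a c) (had : G.Adj a d) (haf : G.Adj a f) (hbc : G.Adj b c)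
    (hbd : G.Adj b d) (hbe : G.Adj b e) (hce : G.Adj c e) (hcf : G.Adj c f)
    (nae : ¬ G.Adj a e) (nbf : ¬ G.Adj b f) (ncd : ¬ G.Adj c d) (nde : ¬ G.Adj d e)
    (ndf : ¬ G.Adj d f) (nef : ¬ G.Adj e f) :
    False := by
  apply hG.f5
  apply isIndContained_of_forall_lt ![d, a, f, b, c, e] <;>
  · simp only [Fin.forall_fin_succ]
    simp [F5]
    grind [G.adj_comm]

/-- A path `a b c d e` and a vertex `q` attached to `b c d`. -/
theorem path_five_add (hG : ObstructionFree G) {a b c d e q : V}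
    (hab : G.Adj a b) (hbc : G.Adj b c) (hbq : G.Adj b q) (hcd : G.Adj c d) (hcq : G.Adj c q)
    (hde : G.Adj d e) (hdq : G.Adj d q)
    (nac : ¬ G.Adj a c) (nad : ¬ G.Adj a d) (nae : ¬ G.Adj a e) (naq : ¬ G.Adj a q)
    (nbd : ¬ G.Adj b d) (nbe : ¬ G.Adj b e) (nce : ¬ G.Adj c e) (neq : ¬ G.Adj e q) :
    False := by
  apply hG.f6
  apply isIndContained_of_forall_lt ![a, b, c, d, e, q] <;>
  · simp only [Fin.forall_fin_succ]
    simp [F6]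
    grind [G.adj_comm]

/-- A path `a b c d e f` and a vertex `q` attached to `b c d e`. -/
theorem path_six_add (hG : ObstructionFree G) {a b c d e f q : V}
    (hab : G.Adj a b) (hbc : G.Adj b c) (hbq : G.Adj b q) (hcd : G.Adj c d) (hcq : G.Adj c q)
    (hde : G.Adj d e) (hdq : G.Adj d q) (hef : G.Adj e f) (heq : G.Adj e q)
    (nac : ¬ G.Adj a c) (nad : ¬ G.Adj a d) (nae : ¬ G.Adj a e) (naf : ¬ G.Adj a f)
    (naq : ¬ G.Adj a q) (nbd : ¬ G.Adj b d) (nbe : ¬ G.Adj b e) (nbf : ¬ G.Adj b f)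
    (nce : ¬ G.Adj c e) (ncf : ¬ G.Adj c f) (ndf : ¬ G.Adj d f) (nfq : ¬ G.Adj f q) :
    False := by
  apply hG.f7
  apply isIndContained_of_forall_lt ![a, b, c, d, e, f, q] <;>
  · simp only [Fin.forall_fin_succ]
    simp [F7]
    grind (splits := 30) [G.adj_comm]

/-- The square of a path `a b c d e f g`. -/
theorem square_path_seven (hG : ObstructionFree G) {a b c d e f g : V}
    (hab : G.Adj a b) (hac : G.Adj a c) (hbc : G.Adj b c) (hbd : G.Adj b d) (hcd : G.Adj c d)
    (hce : G.Adj c e) (hde : G.Adj d e) (hdf : G.Adj d f) (hef : G.Adj e f) (heg : G.Adj e g)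
    (hfg : G.Adj f g)
    (nad : ¬ G.Adj a d) (nae : ¬ G.Adj a e) (naf : ¬ G.Adj a f) (nag : ¬ G.Adj a g)
    (nbe : ¬ G.Adj b e) (nbf : ¬ G.Adj b f) (nbg : ¬ G.Adj b g) (ncf : ¬ G.Adj c f)
    (ncg : ¬ G.Adj c g) (ndg : ¬ G.Adj d g) :
    False := by
  apply hG.f8
  apply isIndContained_of_forall_lt ![a, c, e, g, b, d, f] <;>
  · simp only [Fin.forall_fin_succ]
    simp [F8]
    grind [G.adj_comm]

/-- The square of a path `a b c d e f` and a vertex `q` attached to `b c d e`. -/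
theorem square_path_six_add (hG : ObstructionFree G) {a b c d e f q : V}
    (hab : G.Adj a b) (hac : G.Adj a c) (hbc : G.Adj b c) (hbd : G.Adj b d) (hbq : G.Adj b q)
    (hcd : G.Adj c d) (hce : G.Adj c e) (hcq : G.Adj c q) (hde : G.Adj d e) (hdf : G.Adj d f)
    (hdq : G.Adj d q) (hef : G.Adj e f) (heq : G.Adj e q)
    (nad : ¬ G.Adj a d) (nae : ¬ G.Adj a e) (naf : ¬ G.Adj a f) (naq : ¬ G.Adj a q)
    (nbe : ¬ G.Adj b e) (nbf : ¬ G.Adj b f) (ncf : ¬ G.Adj c f) (nfq : ¬ G.Adj f q) :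
    False := by
  apply hG.f9
  apply isIndContained_of_forall_lt ![a, c, e, b, d, f, q] <;>
  · simp only [Fin.forall_fin_succ]
    simp [F9]
    grind [G.adj_comm]

/-- Four consecutive vertices of an induced path; likewise for five and six below. -/
theorem path_four (hG : ObstructionFree G) {a b c d : V} (hab : G.Adj a b) (hbc : G.Adj b c)
    (hcd : G.Adj c d) (hac : Gᶜ.Adj a c) (hbd : Gᶜ.Adj b d) : Gᶜ.Adj a d := by
  refine hG.chordal.induced_path (fun i => [a, b, c, d].getD i a) 3 ?_ ?_ 3 0 (by omega) (by omega)
    <;> intro i hi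
  · have : i ≤ 2 := by omega
    interval_cases i <;> assumption
  · have : i ≤ 1 := by omega
    interval_cases i <;> assumption

theorem path_five (hG : ObstructionFree G) {a b c d e : V} (hab : G.Adj a b) (hbc : G.Adj b c)
    (hcd : G.Adj c d) (hde : G.Adj d e) (hac : Gᶜ.Adj a c) (hbd : Gᶜ.Adj b d)
    (hce : Gᶜ.Adj c e) : Gᶜ.Adj a e := by
  refine hG.chordal.induced_path (fun i => [a, b, c, d, e].getD i a) 4 ?_ ?_ 4 0 (by omega)
    (by omega) <;> intro i hi
  · have : i ≤ 3 := by omega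
    interval_cases i <;> assumption
  · have : i ≤ 2 := by omega
    interval_cases i <;> assumption

theorem path_six (hG : ObstructionFree G) {a b c d e f : V} (hab : G.Adj a b) (hbc : G.Adj b c)
    (hcd : G.Adj c d) (hde : G.Adj d e) (hef : G.Adj e f) (hac : Gᶜ.Adj a c) (hbd : Gᶜ.Adj b d)
    (hce : Gᶜ.Adj c e) (hdf : Gᶜ.Adj d f) : Gᶜ.Adj a f := by
  refine hG.chordal.induced_path (fun i => [a, b, c, d, e, f].getD i a) 5 ?_ ?_ 5 0 (by omega)
    (by omega) <;> intro i hi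
  · have : i ≤ 4 := by omega
    interval_cases i <;> assumption
  · have : i ≤ 3 := by omega
    interval_cases i <;> assumption

end ObstructionFree
end GallaiForest

/-! ### Turns of a core -/

namespace GallaiForest

open SimpleGraph

variable {V : Type*} {G : SimpleGraph V} {D : V → V → Prop}

/-- A core: a set of edges of `G`, encoded by the symmetric relation `D` of being joined by one of
them, such that every edge of the set with a neighbour of the Gallai graph in the set has a second
one. The field `extend` says this for an edge `jk` with neighbour `ij`: the second neighbour is
either some `kl`, at the other end of `jk`, or some `i'j`, at the same end as `ij`. -/
structure IsGallaiCore (G : SimpleGraph V) (D : V → V → Prop) : Prop where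
  symm : ∀ {i j}, D i j → D j i
  adj : ∀ {i j}, D i j → G.Adj i j
  extend : ∀ {i j k}, D i j → D j k → Gᶜ.Adj i k →
    (∃ l, D k l ∧ Gᶜ.Adj j l) ∨ ∃ i', i' ≠ i ∧ D i' j ∧ Gᶜ.Adj i' k

/-- A turn of a core at the edge `ij`: two different Gallai neighbours `jk` and `jk'` of `ij` in the
core, both at the end `j`. Since claws are excluded, `j k k'` is a triangle to which `i` is attached
at `j`. -/
structure IsTurn (G : SimpleGraph V) (D : V → V → Prop) (i j k k' : V) : Prop where
  left : D i j
  right : D j k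
  right' : D j k'
  ne : k ≠ k'
  compl : Gᶜ.Adj i k
  compl' : Gᶜ.Adj i k'

namespace IsTurn

theorem swap {i j k k' : V} (h : IsTurn G D i j k k') : IsTurn G D i j k' k :=
  ⟨h.left, h.right', h.right, h.ne.symm, h.compl', h.compl⟩

theorem adj {i j k k' : V} (hG : ObstructionFree G) (hD : IsGallaiCore G D)
    (h : IsTurn G D i j k k') : G.Adj k k' := by
  have := hG.claw (hD.adj h.left).symm (hD.adj h.right) (hD.adj h.right')
  grind [h.compl, h.compl', h.ne, compl_adj]

end IsTurn

theorem ObstructionFree.adj_of_claw (hG : ObstructionFree G) {a b c d : V} (ha : G.Adj d a)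
    (hb : G.Adj d b) (hc : G.Adj d c) (hab : Gᶜ.Adj a b) (hac : Gᶜ.Adj a c) (hbc : b ≠ c) :
    G.Adj b c := by
  have := hG.claw ha hb hc
  grind [compl_adj]

/-- If the edge `jk` of a core has two Gallai neighbours `ij` and `i'j` at the same end, while `i'j`
is not a neighbour of `jk'`, then the core leaves `jk'` at its far end, by an edge whose end `l`
prolongs `i, i', j, k', k` to the square of a path. -/
theorem exists_extension_of_sink (hG : ObstructionFree G) (hD : IsGallaiCore G D)
    {i i' j k k' : V} (hij : D i j) (hij' : D i' j) (hjk : D j k) (hjk' : D j k')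
    (hik : Gᶜ.Adj i k) (hik' : Gᶜ.Adj i k') (hi'k : Gᶜ.Adj i' k) (hi'k' : G.Adj i' k')
    (hii' : i ≠ i') :
    ∃ l, G.Adj k' l ∧ Gᶜ.Adj j l ∧ G.Adj k l ∧ Gᶜ.Adj i' l ∧ Gᶜ.Adj i l := by
  have aij := hD.adj hij
  have aij' := hD.adj hij'
  have ajk := hD.adj hjk
  have ajk' := hD.adj hjk'
  have hkk' : k ≠ k' := by rintro rfl; exact hi'k.2 hi'k'
  have akk : G.Adj k k' := hG.adj_of_claw aij.symm ajk ajk' hik hik' hkk'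
  have aii : G.Adj i i' := hG.adj_of_claw ajk aij.symm aij'.symm hik.symm hi'k.symm hii'
  rcases hD.extend hij hjk' hik' with ⟨l, hl, hjl⟩ | ⟨i'', hne, hi'', hn⟩
  · -- the new edge has the right adjacencies: chordality and the 3-sun force them
    have al := hD.adj hl
    have hil : Gᶜ.Adj i l := hG.path_four aij ajk' al hik' hjl
    have hil' : ¬ G.Adj i' l := by
      intro h
      by_cases hkl : G.Adj k l
      · have := hG.four_cycle ajk hkl h.symm aij'
        grind [G.adj_comm, compl_adj]
      · apply hG.sun (a := i') (b := j) (c := k') (d := i) (e := k) (f := l) <;>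
          grind [G.adj_comm, compl_adj]
    have hkl : G.Adj k l := by
      have := hG.claw akk.symm al hi'k'.symm
      grind [G.adj_comm, compl_adj]
    refine ⟨l, al, hjl, hkl, ?_, hil⟩
    grind [G.adj_comm, compl_adj]
  · -- a further edge at the near end gives a chordless cycle or a butterfly
    exfalso
    have a'' := hD.adj hi''
    have : i'' ≠ i' := by rintro rfl; exact hn.2 hi'k'
    have a1 : G.Adj i i'' := hG.adj_of_claw ajk' aij.symm a''.symm hik'.symm hn.symm hne.symm
    by_cases h : G.Adj i'' k
    · by_cases h' : G.Adj i' i''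
      · have := hG.four_cycle hi'k' akk.symm h.symm h'.symm
        grind [G.adj_comm, compl_adj]
      · exact (hG.path_five hi'k' akk.symm h.symm a1.symm hi'k hn.symm hik.symm).2 aii.symm
    · have := hG.butterfly a1 aij a'' akk ajk.symm ajk'.symm
      grind [G.adj_comm, compl_adj]

end GallaiForest

namespace GallaiForest

open SimpleGraph

variable {V : Type*} {G : SimpleGraph V} {D : V → V → Prop}

namespace IsTurn

/-- At a turn, `ij` is the only Gallai neighbour of `jk` in the core at the end `j`: a second one
gives a butterfly, or the square of a path `m, i, i', j, k', k, l`. -/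
theorem no_sink (hG : ObstructionFree G) (hD : IsGallaiCore G D)
    {i i' j k k' : V} (h : IsTurn G D i j k k') (hij' : D i' j) (hi'k : Gᶜ.Adj i' k)
    (hii' : i' ≠ i) : False := by
  have akk := h.adj hG hD
  have aij := hD.adj h.left
  have aij' := hD.adj hij'
  have ajk := hD.adj h.right
  have ajk' := hD.adj h.right'
  have aii : G.Adj i i' :=
    hG.adj_of_claw ajk aij.symm aij'.symm h.compl.symm hi'k.symm hii'.symm
  by_cases hi'k' : G.Adj i' k'
  · obtain ⟨l, h1, h2, h3, h4, h5⟩ := exists_extension_of_sink hG hD h.left hij' h.right h.right'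
      h.compl h.compl' hi'k hi'k' hii'.symm
    -- the configuration is symmetric under exchanging `i, i'` with `k, k'`
    obtain ⟨m, g1, g2, g3, g4, g5⟩ := exists_extension_of_sink hG hD (hD.symm h.right)
      (hD.symm h.right') (hD.symm h.left) (hD.symm hij') h.compl.symm hi'k.symm h.compl'.symm
      hi'k'.symm h.ne
    have hml : Gᶜ.Adj m l := hG.path_four g1.symm hi'k' h1 g4.symm h4
    exact hG.square_path_seven g3.symm g1.symm aii aij aij' hi'k' ajk' ajk akk.symm h1 h3
      g2.symm.2 g4.symm.2 g5.symm.2 hml.2 h.compl'.2 h.compl.2 h5.2 hi'k.2 h4.2 h2.2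
  · have := hG.butterfly aii aij aij' akk ajk.symm ajk'.symm
    grind [h.compl, h.compl', G.adj_comm, compl_adj]

theorem exists_extension (hG : ObstructionFree G) (hD : IsGallaiCore G D)
    {i j k k' : V} (h : IsTurn G D i j k k') : ∃ l, D k l ∧ Gᶜ.Adj j l := by
  rcases hD.extend h.left h.right h.compl with h' | ⟨i', hne, hi', hn⟩
  · exact h'
  · exact (h.no_sink hG hD hi' hn hne).elim

/-- Extend both edges `jk` and `jk'` of a turn, to `l` and `l'`. Since the net is excluded, one of
the new ends is adjacent to the other of the vertices `k`, `k'`. -/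
theorem adj_or_adj (hG : ObstructionFree G) (hD : IsGallaiCore G D)
    {i j k k' l l' : V} (h : IsTurn G D i j k k') (hkl : D k l) (hjl : Gᶜ.Adj j l)
    (hkl' : D k' l') (hjl' : Gᶜ.Adj j l') : G.Adj l k' ∨ G.Adj l' k := by
  by_contra! hn
  have akk := h.adj hG hD
  have aij := hD.adj h.left
  have ajk := hD.adj h.right
  have ajk' := hD.adj h.right'
  have akl := hD.adj hkl
  have akl' := hD.adj hkl'
  have h1 := hG.path_four aij ajk akl h.compl hjl
  have h2 := hG.path_four aij ajk' akl' h.compl' hjl'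
  by_cases hll : G.Adj l l'
  · have := hG.four_cycle akl hll akl'.symm akk.symm
    grind [G.adj_comm, compl_adj]
  · apply hG.net (a := j) (b := k) (c := k') (d := i) (e := l) (f := l') <;>
      grind [h.compl, h.compl', G.adj_comm, compl_adj]

/-- A core cannot go straight on for two steps after a turn, from `jk` to `kl` and then to `lm`, if
`l` is adjacent to `k'`. If `k'` is adjacent to `m`, consider the second Gallai neighbour of `lm` in
the core: if it is at the end `m`, there is a path of six vertices with `k'` attached to its middle;
otherwise it is some `k''l`, where `k''` turns out to be adjacent to `j`, `k`, `k'` and `l`. -/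
theorem no_path (hG : ObstructionFree G) (hD : IsGallaiCore G D)
    {i j k k' l m : V} (h : IsTurn G D i j k k') (hkl : D k l) (hjl : Gᶜ.Adj j l)
    (hlk' : G.Adj l k') (hlm : D l m) (hkm : Gᶜ.Adj k m) : False := by
  have akk := h.adj hG hD
  have aij := hD.adj h.left
  have ajk := hD.adj h.right
  have ajk' := hD.adj h.right'
  have akl := hD.adj hkl
  have alm := hD.adj hlm
  have hil := hG.path_four aij ajk akl h.compl hjl
  have hjm := hG.path_four ajk akl alm hjl hkm
  have him := hG.path_five aij ajk akl alm h.compl hjl hkm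
  have c := h.compl
  have c' := h.compl'
  by_cases hmk' : G.Adj k' m
  swap
  -- otherwise `k'` is attached to the middle of the induced path `i, j, k, l, m`
  · apply hG.path_five_add aij ajk ajk' akl akk alm hlk' <;> grind [G.adj_comm, compl_adj]
  rcases hD.extend hkl hlm hkm with ⟨n, hmn, hln⟩ | ⟨k'', hne, hk'', hn⟩
  · have amn := hD.adj hmn
    have hkn := hG.path_four akl alm amn hkm hln
    have hjn := hG.path_five ajk akl alm amn hjl hkm hln
    have hin := hG.path_six aij ajk akl alm amn h.compl hjl hkm hln
    have hk'n : ¬ G.Adj n k' := fun hnk' => by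
      have := hG.claw ajk'.symm hlk'.symm hnk'.symm
      grind [compl_adj]
    apply hG.path_six_add aij ajk ajk' akl akk alm hlk' amn hmk'.symm <;>
      grind [G.adj_comm, compl_adj]
  · have al := hD.adj hk''
    have a1 : G.Adj k k'' := hG.adj_of_claw alm akl.symm al.symm hkm.symm hn.symm hne.symm
    have hkk : k' ≠ k'' := by rintro rfl; exact hn.2 hmk'
    have a2 : G.Adj k' k'' := by
      by_contra hk
      by_cases hj : G.Adj j k''
      · have := hG.four_cycle hj al hlk' ajk'.symm
        grind [G.adj_comm, compl_adj]
      · apply hG.sun (a := k) (b := k') (c := l) (d := j) (e := m) (f := k'') <;>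
          grind [G.adj_comm, compl_adj]
    have a3 : G.Adj j k'' := by
      have := hG.claw ajk'.symm a2 hmk'
      grind [G.adj_comm, compl_adj]
    by_cases hi : G.Adj i k''
    · apply hG.square_path_six_add (a := i) (b := j) (c := k'') (d := k') (e := l) (f := m)
        (q := k) <;> grind [G.adj_comm, compl_adj]
    · apply hG.path_five_add (a := i) (b := j) (c := k) (d := l) (e := m) (q := k'') <;>
        grind [G.adj_comm, compl_adj]

/-- The core turns at `ij` and goes on to `kl`, where `l` is adjacent to `k'`; suppose that it also
has an edge `j'k` that is a Gallai neighbour of `kl`. Then `j'` is not adjacent to `k'`, since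
otherwise `j j' k k'` is a clique with vertices attached to `j j'` and to `k k'`, or part of the
square of a path `i, w, j, k', k, l` with `j'` attached to its middle. -/
theorem no_clique (hG : ObstructionFree G) (hD : IsGallaiCore G D)
    {i j j' k k' l : V} (h : IsTurn G D i j k k') (hkl : D k l) (hjl : Gᶜ.Adj j l)
    (hlk' : G.Adj l k') (hj'k : D j' k) (hne : j' ≠ j) (hj'l : Gᶜ.Adj j' l)
    (hj'k' : G.Adj j' k') : False := by
  have akk := h.adj hG hD
  have aij := hD.adj h.left
  have ajk := hD.adj h.right
  have ajk' := hD.adj h.right'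
  have akl := hD.adj hkl
  have aj'k := hD.adj hj'k
  have c := h.compl
  have c' := h.compl'
  -- the edges `jk` and `j'k` form a turn at `kl`, to be followed in the opposite direction
  have t : IsTurn G D l k j' j :=
    ⟨hD.symm hkl, hD.symm hj'k, hD.symm h.right, hne, hj'l.symm, hjl.symm⟩
  have ajj := t.adj hG hD
  have hil := hG.path_four aij ajk akl h.compl hjl
  by_cases hi : G.Adj i j'
  · apply hG.clique_four (a := j) (b := j') (c := k) (d := k') (e := i) (f := l) <;>
      grind [G.adj_comm, compl_adj]
  obtain ⟨w, hw, hkw⟩ := t.exists_extension hG hD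
  have aw := hD.adj hw
  have hwj : G.Adj w j :=
    (t.adj_or_adj hG hD hw hkw (hD.symm h.left) c.symm).resolve_right hi
  have hwl := hG.path_four aw.symm aj'k akl hkw.symm hj'l
  by_cases hwk' : G.Adj w k'
  · have hiw : G.Adj i w :=
      hG.adj_of_claw ajk aij.symm hwj.symm c.symm hkw (by rintro rfl; exact hi aw.symm)
    apply hG.square_path_six_add (a := i) (b := w) (c := j) (d := k') (e := k) (f := l)
      (q := j') <;> grind [G.adj_comm, compl_adj]
  · apply hG.clique_four (a := j) (b := j') (c := k) (d := k') (e := w) (f := l) <;>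
      grind [G.adj_comm, compl_adj]

/-- The second Gallai neighbour of `kl` in the core makes a turn in the opposite direction. -/
theorem exists_opposite (hG : ObstructionFree G) (hD : IsGallaiCore G D)
    {i j k k' l : V} (h : IsTurn G D i j k k') (hkl : D k l) (hjl : Gᶜ.Adj j l)
    (hlk' : G.Adj l k') :
    ∃ j', IsTurn G D l k j' j ∧ ¬ G.Adj j' k' := by
  rcases hD.extend h.right hkl hjl with ⟨m, hm, hkm⟩ | ⟨j', hne, hj', hn⟩
  · exact (h.no_path hG hD hkl hjl hlk' hm hkm).elim
  · exact ⟨j', ⟨hD.symm hkl, hD.symm hj', hD.symm h.right, hne, hn.symm, hjl.symm⟩,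
      h.no_clique hG hD hkl hjl hlk' hj' hne hn⟩

/-- In a turn with both edges extended, to `l` and `l'`, the end `l` is not adjacent to `k'`:
together with the opposite turn at `kl` this would give a 3-sun or the square of a path
`p, j', j, k, k', l, l'`. -/
theorem no_crossing (hG : ObstructionFree G) (hD : IsGallaiCore G D)
    {i j k k' l l' : V} (h : IsTurn G D i j k k') (hkl : D k l) (hjl : Gᶜ.Adj j l)
    (hkl' : D k' l') (hjl' : Gᶜ.Adj j l') (hlk' : G.Adj l k') : False := by
  obtain ⟨j', t, hj'k'⟩ := h.exists_opposite hG hD hkl hjl hlk'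
  have akk := h.adj hG hD
  have aij := hD.adj h.left
  have ajk := hD.adj h.right
  have ajk' := hD.adj h.right'
  have akl := hD.adj hkl
  have akl' := hD.adj hkl'
  have ajj := t.adj hG hD
  have aj'k := hD.adj t.right
  have c := h.compl
  have c' := h.compl'
  have d := t.compl
  by_cases hl'k : G.Adj l' k
  · -- there is an opposite turn at `k'l'` as well
    obtain ⟨j'', t', hj''k⟩ := h.swap.exists_opposite hG hD hkl' hjl' hl'k
    have ajj'' := t'.adj hG hD
    have aj''k := hD.adj t'.right
    have d' := t'.compl
    by_cases hjj : G.Adj j' j''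
    · have := hG.four_cycle hjj aj''k.symm akk.symm aj'k
      grind [G.adj_comm, compl_adj]
    · by_cases hj''l : G.Adj j'' l
      · have := hG.four_cycle hj''l akl.symm ajk.symm ajj''.symm
        grind [G.adj_comm, compl_adj]
      · apply hG.sun (a := j) (b := k) (c := k') (d := j') (e := l) (f := j'') <;>
          grind [G.adj_comm, compl_adj]
  · -- the opposite turn supplies a vertex `p` attached to `j` and `j'` only
    obtain ⟨p, h1, h2, h3, h4⟩ : ∃ p, G.Adj p j' ∧ G.Adj p j ∧ Gᶜ.Adj p k ∧ Gᶜ.Adj p k' := by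
      by_cases hi : G.Adj i j'
      · exact ⟨i, hi, aij, c, c'⟩
      obtain ⟨w, hw, hkw⟩ := t.exists_extension hG hD
      have aw := hD.adj hw
      have hwj : G.Adj w j :=
        (t.adj_or_adj hG hD hw hkw (hD.symm h.left) c.symm).resolve_right hi
      refine ⟨w, aw.symm, hwj, hkw.symm, ?_⟩
      have : ¬ G.Adj w k' := fun hwk' => by
        have := hG.four_cycle hwk' akk.symm aj'k aw
        grind [G.adj_comm, compl_adj]
      grind [G.adj_comm, compl_adj]
    have hpl := hG.path_four h2 ajk akl h3 hjl
    have hpl' := hG.path_four h2 ajk' akl' h4 hjl'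
    have hll : G.Adj l l' :=
      hG.adj_of_claw ajk'.symm hlk'.symm akl' hjl hjl' (by rintro rfl; exact hl'k akl.symm)
    have hj'l' : ¬ G.Adj j' l' := fun hn => by
      have := hG.four_cycle hn akl'.symm akk.symm aj'k
      grind [G.adj_comm, compl_adj]
    apply hG.square_path_seven (a := p) (b := j') (c := j) (d := k) (e := k') (f := l)
      (g := l') <;> grind [G.adj_comm, compl_adj]

theorem false (hG : ObstructionFree G) (hD : IsGallaiCore G D)
    {i j k k' : V} (h : IsTurn G D i j k k') : False := by
  obtain ⟨l, hkl, hjl⟩ := h.exists_extension hG hD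
  obtain ⟨l', hkl', hjl'⟩ := h.swap.exists_extension hG hD
  rcases h.adj_or_adj hG hD hkl hjl hkl' hjl' with h' | h'
  · exact h.no_crossing hG hD hkl hjl hkl' hjl' h'
  · exact h.swap.no_crossing hG hD hkl' hjl' hkl hjl h'

end IsTurn

end GallaiForest

/-! ### Cycles of the Gallai graph -/

namespace GallaiForest

open SimpleGraph

variable {V : Type*} {G : SimpleGraph V} {D : V → V → Prop}

/-- Without turns, a pair of Gallai-adjacent edges of a core would start an infinite walk, all of
whose finite pieces are induced paths. -/
theorem IsGallaiCore.false [Finite V] (hG : ObstructionFree G) (hD : IsGallaiCore G D) {i j k : V}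
    (hij : D i j) (hjk : D j k) (hik : Gᶜ.Adj i k) : False := by
  -- the states of the walk: pairs of consecutive edges, oriented in the direction of travel
  let S := {p : V × V × V // D p.1 p.2.1 ∧ D p.2.1 p.2.2 ∧ Gᶜ.Adj p.1 p.2.2}
  have hstep : ∀ p : S, ∃ q : S, q.1.1 = p.1.2.1 ∧ q.1.2.1 = p.1.2.2 := by
    rintro ⟨⟨a, b, c⟩, hab, hbc, hac⟩
    rcases hD.extend hab hbc hac with ⟨d, hd, hbd⟩ | ⟨a', hne, ha', hn⟩
    · exact ⟨⟨(b, c, d), hbc, hd, hbd⟩, rfl, rfl⟩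
    · have t : IsTurn G D c b a a' :=
        ⟨hD.symm hbc, hD.symm hab, hD.symm ha', hne.symm, hac.symm, hn.symm⟩
      exact (t.false hG hD).elim
  choose next hnext hnext' using hstep
  let y : ℕ → S := fun n => next^[n] ⟨(i, j, k), hij, hjk, hik⟩
  have hy : ∀ n, y (n + 1) = next (y n) := fun n => Function.iterate_succ_apply' _ _ _
  let x : ℕ → V := fun n => (y n).1.1
  have h1 : ∀ n, x (n + 1) = (y n).1.2.1 := fun n => by
    simp only [x, hy, hnext]
  have h2 : ∀ n, x (n + 2) = (y n).1.2.2 := fun n => by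
    rw [show n + 2 = n + 1 + 1 from rfl, h1, hy, hnext']
  have hx1 : ∀ n, G.Adj (x n) (x (n + 1)) := fun n => by
    rw [h1]
    exact hD.adj (y n).2.1
  have hx2 : ∀ n, Gᶜ.Adj (x n) (x (n + 2)) := fun n => by
    rw [h2]
    exact (y n).2.2.2
  have hinj : ∀ m n, m < n → x m ≠ x n := by
    intro m n hmn
    obtain rfl | h : n = m + 1 ∨ m + 2 ≤ n := by omega
    · exact (hx1 m).ne
    · have := hG.chordal.induced_path x n (fun i _ => hx1 i) (fun i _ => hx2 i) (n - m) m
        (by omega) (by omega)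
      rw [show m + (n - m) = n by omega] at this
      exact this.ne
  obtain ⟨m, n, hmn, h⟩ := Finite.exists_ne_map_eq_of_infinite x
  rcases lt_or_gt_of_ne hmn with h' | h'
  · exact hinj m n h' h
  · exact hinj n m h' h.symm

/-- The edges on a cycle of the Gallai graph form a core. -/
theorem isGallaiCore_of_isCycle {e : G.edgeSet} {c : G.gallaiGraph.Walk e e} (hc : c.IsCycle) :
    IsGallaiCore G fun u v => ∃ f ∈ c.support, (f : Sym2 V) = s(u, v) where
  symm := by
    rintro i j ⟨f, hf, h⟩
    exact ⟨f, hf, h.trans Sym2.eq_swap⟩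
  adj := by
    rintro i j ⟨f, hf, h⟩
    have := f.2
    rwa [h] at this
  extend := by
    rintro i j k ⟨f, hf, hfe⟩ ⟨g, hg, hge⟩ hik
    have h2 := hc.ncard_neighborSet_toSubgraph_eq_two hg
    obtain ⟨g', hg', hne⟩ : ∃ g' ∈ c.toSubgraph.neighborSet g, g' ≠ f :=
      Set.exists_ne_of_one_lt_ncard (by omega) f
    have hadj := c.toSubgraph.adj_sub hg'
    have hmem : g' ∈ c.support := c.mem_verts_toSubgraph.1 (c.toSubgraph.edge_vert hg'.symm)
    obtain ⟨hgg, u, v, w, hu, hv, hvw⟩ := hadj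
    have hne' : v ≠ w := by
      rintro rfl
      exact hgg (Subtype.ext (hu.trans hv.symm))
    rw [hge] at hu
    rcases Sym2.eq_iff.1 hu with ⟨rfl, rfl⟩ | ⟨rfl, rfl⟩
    · refine Or.inr ⟨w, ?_, ⟨g', hmem, hv.trans Sym2.eq_swap⟩, ?_⟩
      · rintro rfl
        exact hne (Subtype.ext (hv.trans (Sym2.eq_swap.trans hfe.symm)))
      · exact ⟨hne'.symm, fun h => hvw h.symm⟩
    · exact Or.inl ⟨w, ⟨g', hmem, hv⟩, hne', hvw⟩

theorem ObstructionFree.isAcyclic_gallaiGraph [Finite V] (hG : ObstructionFree G) :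
    G.gallaiGraph.IsAcyclic := by
  intro e c hc
  have hD := isGallaiCore_of_isCycle hc
  have hmem : c.snd ∈ c.support := c.getVert_mem_support 1
  obtain ⟨hne, u, v, w, hu, hv, hvw⟩ := c.adj_snd hc.not_nil
  refine hD.false hG (i := v) (j := u) (k := w) ⟨e, c.start_mem_support, hu.trans Sym2.eq_swap⟩
    ⟨_, hmem, hv⟩ ⟨?_, hvw⟩
  rintro rfl
  exact hne (Subtype.ext (hu.trans hv.symm))

theorem obstructionFree_of_isAcyclic (hG : G.gallaiGraph.IsAcyclic) : ObstructionFree G where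
  chordal _ hn h := not_isAcyclic_gallaiGraph_cycleGraph hn (h.isAcyclic_gallaiGraph hG)
  f1 h := F1_not_isAcyclic (h.isAcyclic_gallaiGraph hG)
  f2 h := F2_not_isAcyclic (h.isAcyclic_gallaiGraph hG)
  f3 h := F3_not_isAcyclic (h.isAcyclic_gallaiGraph hG)
  f4 h := F4_not_isAcyclic (h.isAcyclic_gallaiGraph hG)
  f5 h := F5_not_isAcyclic (h.isAcyclic_gallaiGraph hG)
  f6 h := F6_not_isAcyclic (h.isAcyclic_gallaiGraph hG)
  f7 h := F7_not_isAcyclic (h.isAcyclic_gallaiGraph hG)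
  f8 h := F8_not_isAcyclic (h.isAcyclic_gallaiGraph hG)
  f9 h := F9_not_isAcyclic (h.isAcyclic_gallaiGraph hG)

end GallaiForest

theorem theorem1 {V : Type*} [Finite V] (G : SimpleGraph V) :
    G.gallaiGraph.IsAcyclic ↔
      G.IsChordal ∧
        ¬ GallaiForest.F1.IsIndContained G ∧ ¬ GallaiForest.F2.IsIndContained G ∧
        ¬ GallaiForest.F3.IsIndContained G ∧ ¬ GallaiForest.F4.IsIndContained G ∧
        ¬ GallaiForest.F5.IsIndContained G ∧ ¬ GallaiForest.F6.IsIndContained G ∧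
        ¬ GallaiForest.F7.IsIndContained G ∧ ¬ GallaiForest.F8.IsIndContained G ∧
        ¬ GallaiForest.F9.IsIndContained G := by
  constructor
  · intro h
    obtain ⟨h0, h1, h2, h3, h4, h5, h6, h7, h8, h9⟩ := GallaiForest.obstructionFree_of_isAcyclic h
    exact ⟨h0, h1, h2, h3, h4, h5, h6, h7, h8, h9⟩
  · rintro ⟨h0, h1, h2, h3, h4, h5, h6, h7, h8, h9⟩
    exact (GallaiForest.ObstructionFree.mk h0 h1 h2 h3 h4 h5 h6 h7 h8
      h9).isAcyclic_gallaiGraph
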